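/- Let $a,b\in[-\infty,+\infty]$ with $a<b$, let $S_{a,b}=\{z\in\mathbb C : a<\operatorname{Im} z<b\}$, and let $f:S_{a,b}\to\mathbb C$ be a function. Call $f$ positive definite in $S_{a,b}$ if for every $n\in\mathbb N$ and all $z_1,\dots,z_n\in\mathbb C$ with $z_k-\overline{z_l}\in S_{a,b}$ for all $k,l$, one has $$\sum_{k,l=1}^n f(z_k-\overline{z_l})\,\xi_k\overline{\xi_l}\ \ge\ 0\qquad\text{for all }\xi_1,\dots,\xi_n\in\mathbb C$$ (that is, the sum is real and non-negative). Call a non-negative Borel measure $\mu$ on $\mathbb R$ exponentially finite with respect to $(a,b)$ if $\int_{\mathbb R}e^{-yt}\,d\mu(t)<\infty$ for every real $y\in(a,b)$. Then $f$ is holomorphic and positive definite in $S_{a,b}$ if and only if there is a non-negative Borel measure $\mu$ on $\mathbb R$, exponentially finite with respect to $(a,b)$, such that $$f(z)=\int_{\mathbb R}e^{izt}\,d\mu(t)\qquad\text{for all }z\in S_{a,b}.$$ Furthermore, the measure $\mu$ is uniquely determined by $f$: any two non-negative Borel measures on $\mathbb R$ that are exponentially finite with respect to $(a,b)$ and satisfy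 this identity on $S_{a,b}$ are equal. -/

import Mathlib

open scoped ComplexOrder ComplexConjugate

/-- The real open interval `(a, b)` with extended real endpoints. -/
def openInterval (a b : EReal) : Set ℝ :=
  {y : ℝ | a < (y : EReal) ∧ (y : EReal) < b}

/-- The horizontal strip `S_{a,b} = {z : a < Im z < b}` with extended real endpoints. -/
def horizontalStrip (a b : EReal) : Set ℂ :=
  {z : ℂ | a < (z.im : EReal) ∧ (z.im : EReal) < b}

/-- `f` is positive definite in `S ⊆ ℂ`: for all finite families `z` with every
`z k - conj (z l)` in `S`, the matrix `[f (z k - conj (z l))]` is positive semidefinite.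
The inequality `0 ≤ w` for a complex `w` means that `w` is real and non-negative. -/
def IsPositiveDefiniteOn (f : ℂ → ℂ) (S : Set ℂ) : Prop :=
  ∀ (n : ℕ) (z : Fin n → ℂ), (∀ k l, z k - conj (z l) ∈ S) →
    ∀ ξ : Fin n → ℂ, 0 ≤ ∑ k, ∑ l, f (z k - conj (z l)) * ξ k * conj (ξ l)

/-- A non-negative Borel measure `μ` on `ℝ` is exponentially finite with respect to `J` if
`∫ exp (-y t) dμ(t) < ∞` for every `y ∈ J`. -/
def IsExponentiallyFinite (μ : MeasureTheory.Measure ℝ) (J : Set ℝ) : Prop :=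
  ∀ y ∈ J, ∫⁻ t, ENNReal.ofReal (Real.exp (-y * t)) ∂μ < ⊤

/-- The Fourier-Laplace transform `z ↦ ∫ exp (i z t) dμ(t)`. The integrand has modulus
`exp (-(Im z) t)`, so the integral converges absolutely for `Im z ∈ J` as soon as `μ` is
exponentially finite with respect to `J`. -/
noncomputable def fourierLaplace (μ : MeasureTheory.Measure ℝ) (z : ℂ) : ℂ :=
  ∫ t : ℝ, Complex.exp (Complex.I * z * (t : ℂ)) ∂μ

/-!
# Bochner's theorem for holomorphic functions on a strip

Let `f` be holomorphic and positive definite on the strip `Im z ∈ J`, and suppose that `0 ∈ J`;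
a vertical translation reduces to this case. On each horizontal line `x ↦ f (x + i y)` is a positive
definite function on `ℝ`, hence bounded by `f (i y)`. Multiply `f` by the Gaussian
`exp (-z² / (2 v))` to make it integrable on lines.

The Fourier transform `p` of the damped function on the real line is non-negative: a Gaussian is the
law of a difference of two independent Gaussians, so `p w` is an integral of the quadratic form that
positive definiteness controls (`IsPositiveDefiniteReal.fourier_mul_gaussian_nonneg`). Moving the
line of integration (`fourier_gaussianSlice`) shows that the Fourier transform on the line `Im z = y`
is `exp (-2 π y w) p w`, which is then non-negative for every `y ∈ J`. A non-negative Fourier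
transform of an integrable continuous function has integral at most the value of that function at `0`
(`lintegral_fourier_le`). Hence Fourier inversion holds for the damped function on the real line, and
`∫ exp (-2 π y w) p w dw` is at most `f (i y) exp (y² / (2 v))`, uniformly bounded in `v ≥ 1`.

As `v → ∞` the densities `p`, viewed as measures, have characteristic functions converging to `f`,
up to a scaling of the variable. So they are tight, a subsequence converges weakly, and the bounds
above pass to the limit measure (`exists_probabilityMeasure_charFun_eq`). Its Fourier-Laplace
transform is therefore holomorphic on the strip; it equals `f` on the real line, hence everywhere.

Conversely, a Fourier-Laplace transform is holomorphic by differentiation under the integral sign, and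
its quadratic forms are integrals of squared moduli. Uniqueness is the injectivity of the
characteristic function, applied to the finite measure `exp (-c t) dμ(t)` for one `c ∈ J`.
-/

open MeasureTheory ProbabilityTheory Filter Topology Complex FourierTransform
open scoped MeasureTheory NNReal ENNReal

/-! ### Positive definite functions on the real line -/

/-- A function `g : ℝ → ℂ` is positive definite if every matrix `[g (x k - x l)]` is positive
semidefinite. -/
def IsPositiveDefiniteReal (g : ℝ → ℂ) : Prop :=
  ∀ (n : ℕ) (x : Fin n → ℝ) (ξ : Fin n → ℂ), 0 ≤ ∑ k, ∑ l, g (x k - x l) * ξ k * conj (ξ l)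

namespace IsPositiveDefiniteReal

variable {g : ℝ → ℂ}

lemma apply_zero_nonneg (hg : IsPositiveDefiniteReal g) : 0 ≤ g 0 := by
  simpa using hg 1 (fun _ ↦ 0) (fun _ ↦ 1)

/-- The `2 × 2` case of positive definiteness, at the points `x` and `0`. -/
lemma norm_le (hg : IsPositiveDefiniteReal g) (x : ℝ) : ‖g x‖ ≤ (g 0).re := by
  have h0 := hg.apply_zero_nonneg
  have key (w : ℂ) : 0 ≤ g 0 * (1 + w * conj w) + g x * conj w + g (-x) * w := by
    have := hg 2 ![x, 0] ![1, w]
    simp only [Fin.sum_univ_two, Matrix.cons_val_zero, Matrix.cons_val_one, sub_self, sub_zero,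
      zero_sub, map_one, mul_one] at this
    convert this using 1
    ring
  -- The quadratic forms at `w = 1` and `w = I` are real, which forces `g (-x) = conj (g x)`.
  have h1 := (Complex.le_def.1 (key 1)).2
  have h2 := (Complex.le_def.1 (key I)).2
  have h00 := (Complex.le_def.1 h0).2
  simp at h1 h2 h00
  have hconj : g (-x) = conj (g x) := by
    apply Complex.ext <;> simp <;> linarith
  by_cases hx : g x = 0
  · simpa [hx] using (Complex.le_def.1 h0).1
  have hn : (‖g x‖ : ℂ) ≠ 0 := by simpa using hx
  -- The unimodular `w = -g x / ‖g x‖` turns the quadratic form into `2 * (g 0 - ‖g x‖)`.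
  have h3 := key (-(g x / ‖g x‖))
  have hw : g x * conj (g x) = (‖g x‖ : ℂ) ^ 2 := Complex.mul_conj' _
  have h4 : g 0 * (1 + -(g x / ‖g x‖) * conj (-(g x / ‖g x‖))) + g x * conj (-(g x / ‖g x‖))
      + g (-x) * (-(g x / ‖g x‖)) = 2 * (g 0 - ‖g x‖) := by
    rw [hconj]
    simp only [map_neg, map_div₀, conj_ofReal]
    have e : g x / ‖g x‖ * (conj (g x) / ‖g x‖) = 1 := by
      rw [div_mul_div_comm, hw]; field_simp
    have e' : g x * (conj (g x) / ‖g x‖) = ‖g x‖ := by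
      rw [← mul_div_assoc, hw]; field_simp
    have e'' : conj (g x) * (g x / ‖g x‖) = ‖g x‖ := by
      rw [← mul_div_assoc, mul_comm, hw]; field_simp
    linear_combination g 0 * e - e' - e''
  rw [h4] at h3
  have := (Complex.le_def.1 h3).1
  simp at this
  linarith

/-- Multiplication by the character `x ↦ exp (i s x)` preserves positive definiteness: the
character is absorbed into the coefficients `ξ`. -/
lemma mul_character (hg : IsPositiveDefiniteReal g) (s : ℝ) :
    IsPositiveDefiniteReal fun x ↦ cexp ((s * x : ℝ) * I) * g x := by
  intro n x ξ
  convert hg n x (fun k ↦ cexp ((s * x k : ℝ) * I) * ξ k) using 3 with k _ l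
  have : cexp ((s * (x k - x l) : ℝ) * I)
      = cexp ((s * x k : ℝ) * I) * conj (cexp ((s * x l : ℝ) * I)) := by
    rw [← Complex.exp_conj, ← Complex.exp_add]
    congr 1
    simp
    ring
  simp only [this, map_mul]
  ring

/-- Positive definiteness passes from sums to integrals. The sums are averaged over independent
random points `x 1, …, x n` with law `P`: the `n` diagonal terms contribute `n * g 0`, the others
`n * (n - 1)` times the double integral, which dominates as `n → ∞`. -/
lemma integral_prod_nonneg (hg : IsPositiveDefiniteReal g) (hc : Continuous g)
    (P : Measure ℝ) [IsProbabilityMeasure P] :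
    0 ≤ ∫ z, g (z.1 - z.2) ∂(P.prod P) := by
  set J := ∫ z, g (z.1 - z.2) ∂(P.prod P) with hJ
  have key (n : ℕ) : 0 ≤ (n : ℂ) * n * J + n * (g 0 - J) := by
    set μ := Measure.pi (fun _ : Fin n ↦ P) with hμ
    have hint (k l : Fin n) : Integrable (fun x : Fin n → ℝ ↦ g (x k - x l)) μ :=
      Integrable.of_bound (Continuous.aestronglyMeasurable (by fun_prop)) (g 0).re
        (ae_of_all _ fun x ↦ hg.norm_le _)
    have hval (k l : Fin n) :
        ∫ x, g (x k - x l) ∂μ = J + if k = l then g 0 - J else 0 := by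
      split_ifs with h
      · simp [h]
      · have hind : iIndepFun (fun (i : Fin n) (x : Fin n → ℝ) ↦ x i) μ :=
          iIndepFun_pi (X := fun _ ↦ id) (fun _ ↦ aemeasurable_id)
        have hmap := (indepFun_iff_map_prod_eq_prod_map_map
          (measurable_pi_apply k).aemeasurable (measurable_pi_apply l).aemeasurable).1
          (hind.indepFun h)
        rw [(measurePreserving_eval (fun _ : Fin n ↦ P) k).map_eq,
          (measurePreserving_eval (fun _ : Fin n ↦ P) l).map_eq] at hmap
        rw [add_zero, hJ, ← hmap, integral_map (by fun_prop)
          (Continuous.aestronglyMeasurable (by fun_prop))]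
    have h1 : 0 ≤ ∫ x, ∑ k, ∑ l, g (x k - x l) ∂μ :=
      integral_nonneg fun x ↦ by simpa using hg n x (fun _ ↦ 1)
    rw [integral_finsetSum _ fun k _ ↦ integrable_finsetSum _ fun l _ ↦ hint k l] at h1
    simp_rw [integral_finsetSum _ fun l _ ↦ hint _ l, hval] at h1
    convert h1 using 1
    simp [Finset.sum_add_distrib]
    ring
  have hlim : Tendsto (fun n : ℕ ↦ J + (g 0 - J) / n) atTop (𝓝 (J + 0)) :=
    tendsto_const_nhds.add (tendsto_const_div_atTop_nhds_zero_nat _)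
  rw [add_zero] at hlim
  refine ge_of_tendsto hlim ?_
  filter_upwards [eventually_gt_atTop 0] with n hn
  have hn' : (n : ℂ) ≠ 0 := by exact_mod_cast hn.ne'
  have h2 : (0 : ℂ) ≤ ((n : ℝ)⁻¹ ^ 2 : ℝ) := by
    rw [Complex.zero_le_real]; positivity
  convert mul_nonneg h2 (key n) using 1
  push_cast
  field_simp

end IsPositiveDefiniteReal

lemma gaussianReal_prod_map_sub (v : ℝ≥0) :
    ((gaussianReal 0 v).prod (gaussianReal 0 v)).map (fun z ↦ z.1 - z.2)
      = gaussianReal 0 (v + v) := by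
  have h : gaussianReal 0 v ∗ gaussianReal 0 v = gaussianReal 0 (v + v) := by
    simp [gaussianReal_conv_gaussianReal]
  have hneg : (gaussianReal 0 v).map (fun x ↦ -x) = gaussianReal 0 v := by
    simp [gaussianReal_map_neg]
  rw [← h, Measure.conv]
  nth_rewrite 4 [← hneg]
  nth_rewrite 3 [← Measure.map_id (μ := gaussianReal 0 v)]
  rw [Measure.map_prod_map _ _ measurable_id measurable_neg, Measure.map_map (by fun_prop)
    (by fun_prop)]
  congr 1

/-- A Gaussian with variance `2 v` is the law of a difference of two independent Gaussians with
variance `v`, so that the Fourier integral below is a double integral of `g (x - y)`. -/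
lemma IsPositiveDefiniteReal.fourier_mul_gaussian_nonneg {g : ℝ → ℂ}
    (hg : IsPositiveDefiniteReal g) (hc : Continuous g) {v : ℝ≥0} (hv : v ≠ 0) (w : ℝ) :
    0 ≤ 𝓕 (fun x : ℝ ↦ g x * cexp (-(x : ℂ) ^ 2 / (2 * v))) w := by
  have h := (hg.mul_character (-2 * Real.pi * w)).integral_prod_nonneg (by fun_prop)
    (gaussianReal 0 (v / 2))
  rw [← integral_map (μ := (gaussianReal 0 (v / 2)).prod (gaussianReal 0 (v / 2)))
    (φ := fun z ↦ z.1 - z.2) (f := fun x ↦ cexp ((-2 * Real.pi * w * x : ℝ) * I) * g x)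
    (by fun_prop) (Continuous.aestronglyMeasurable (by fun_prop)), gaussianReal_prod_map_sub,
    add_halves, integral_gaussianReal_eq_integral_smul hv] at h
  rw [Real.fourier_real_eq_integral_exp_smul]
  have hpos : (0 : ℂ) ≤ (√(2 * Real.pi * v) : ℝ) := by
    rw [Complex.zero_le_real]; positivity
  have hne : √(2 * Real.pi * v) ≠ 0 := by
    have : (0 : ℝ) < v := by positivity
    positivity
  convert mul_nonneg hpos h using 1
  rw [← integral_const_mul]
  congr 1 with x
  simp only [gaussianPDFReal, smul_eq_mul, Complex.real_smul, sub_zero]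
  push_cast
  have hne' : ((√(2 * Real.pi * v) : ℝ) : ℂ) ≠ 0 := by exact_mod_cast hne
  field_simp

/-! ### Integrability of non-negative Fourier transforms -/

/-- A non-negative Fourier transform is integrable: by Parseval, its integrals against wider and
wider Gaussians converge to `h 0`, and Fatou's lemma applies. -/
lemma lintegral_fourier_le {h : ℝ → ℂ} (hi : Integrable h) (hc : ContinuousAt h 0)
    (hpos : ∀ w, 0 ≤ 𝓕 h w) :
    ∫⁻ w, ENNReal.ofReal (𝓕 h w).re ≤ ENNReal.ofReal (h 0).re := by
  have hcont : Continuous (𝓕 h) :=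
    VectorFourier.fourierIntegral_continuous Real.continuous_fourierChar
      (by exact continuous_inner) hi
  have hlim : Tendsto (fun c : ℝ ↦ ∫ w : ℝ, cexp (-(c : ℂ)⁻¹ * ‖w‖ ^ 2) • 𝓕 h w) atTop (𝓝 (h 0)) := by
    refine (Real.tendsto_integral_gaussian_smul' hi hc).congr' ?_
    filter_upwards [Ioi_mem_atTop 0] with c (hc : 0 < c)
    have hre : 0 < ((c : ℂ)⁻¹).re := by
      rw [← ofReal_inv, ofReal_re]; positivity
    have J : Integrable (fun w : ℝ ↦ cexp (-(c : ℂ)⁻¹ * ‖w‖ ^ 2)) := by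
      simpa using GaussianFourier.integrable_cexp_neg_mul_sq_norm_add (V := ℝ) hre 0 0
    have e := VectorFourier.integral_fourierIntegral_smul_eq_flip (L := innerₗ ℝ) (μ := volume)
      (ν := volume) Real.continuous_fourierChar continuous_inner J hi
    rw [flip_innerₗ] at e
    refine Eq.trans (integral_congr_ae (ae_of_all _ fun w ↦ ?_)) e
    have := fourier_gaussian_innerProductSpace (V := ℝ) hre w
    change _ = 𝓕 (fun w : ℝ ↦ cexp (-(c : ℂ)⁻¹ * ‖w‖ ^ 2)) w • h w
    rw [this]
    simp only [zero_sub, norm_neg, div_inv_eq_mul]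
    ring_nf
  have hint (n : ℕ) : Integrable fun w : ℝ ↦ cexp (-((n + 1 : ℝ) : ℂ)⁻¹ * ‖w‖ ^ 2) • 𝓕 h w := by
    have hre : 0 < (((n + 1 : ℝ) : ℂ)⁻¹).re := by
      rw [← ofReal_inv, ofReal_re]; positivity
    have J : Integrable (fun w : ℝ ↦ cexp (-((n + 1 : ℝ) : ℂ)⁻¹ * ‖w‖ ^ 2)) := by
      simpa using GaussianFourier.integrable_cexp_neg_mul_sq_norm_add (V := ℝ) hre 0 0
    refine J.mul_bdd (c := ∫ v, ‖h v‖) hcont.aestronglyMeasurable (ae_of_all _ fun w ↦ ?_)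
    exact VectorFourier.norm_fourierIntegral_le_integral_norm _ _ _ _ _
  have hre (n : ℕ) (w : ℝ) : (cexp (-((n + 1 : ℝ) : ℂ)⁻¹ * ‖w‖ ^ 2) • 𝓕 h w).re
      = Real.exp (-(n + 1 : ℝ)⁻¹ * ‖w‖ ^ 2) * (𝓕 h w).re := by
    rw [smul_eq_mul, ← re_ofReal_mul]
    push_cast
    rfl
  have hlim' := (((ENNReal.continuous_ofReal.comp Complex.continuous_re).tendsto _).comp
    hlim).comp ((tendsto_atTop_add_const_right atTop (1 : ℝ) tendsto_natCast_atTop_atTop))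
  have hptw (w : ℝ) : Tendsto (fun n : ℕ ↦ ENNReal.ofReal
      (cexp (-((n + 1 : ℝ) : ℂ)⁻¹ * ‖w‖ ^ 2) • 𝓕 h w).re) atTop
      (𝓝 (ENNReal.ofReal (𝓕 h w).re)) := by
    refine ENNReal.tendsto_ofReal ?_
    simp_rw [hre]
    have : Tendsto (fun n : ℕ ↦ Real.exp (-(n + 1 : ℝ)⁻¹ * ‖w‖ ^ 2) * (𝓕 h w).re) atTop
        (𝓝 (Real.exp (-0 * ‖w‖ ^ 2) * (𝓕 h w).re)) := by
      refine Tendsto.mul_const _ ((Real.continuous_exp.tendsto _).comp (Tendsto.mul_const _ ?_))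
      exact (tendsto_inv_atTop_zero.comp
        (tendsto_atTop_add_const_right atTop (1 : ℝ) tendsto_natCast_atTop_atTop)).neg
    simpa using this
  calc ∫⁻ w, ENNReal.ofReal (𝓕 h w).re
      = ∫⁻ w, liminf (fun n : ℕ ↦ ENNReal.ofReal
          (cexp (-((n + 1 : ℝ) : ℂ)⁻¹ * ‖w‖ ^ 2) • 𝓕 h w).re) atTop := by
        simp_rw [fun w ↦ (hptw w).liminf_eq]
    _ ≤ liminf (fun n : ℕ ↦ ∫⁻ w, ENNReal.ofReal
          (cexp (-((n + 1 : ℝ) : ℂ)⁻¹ * ‖w‖ ^ 2) • 𝓕 h w).re) atTop :=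
        lintegral_liminf_le fun n ↦ by fun_prop
    _ = liminf (fun n : ℕ ↦ ENNReal.ofReal
          (∫ w : ℝ, cexp (-((n + 1 : ℝ) : ℂ)⁻¹ * ‖w‖ ^ 2) • 𝓕 h w).re) atTop := by
        congr 1 with n
        refine (ofReal_integral_eq_lintegral_ofReal (hint n).re (ae_of_all _ fun w ↦ ?_)).symm.trans
          (congrArg ENNReal.ofReal (integral_re (hint n)))
        simp only [RCLike.re_to_complex, hre]
        exact mul_nonneg (Real.exp_nonneg _) (Complex.le_def.1 (hpos w)).1
    _ = ENNReal.ofReal (h 0).re := hlim'.liminf_eq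

/-- Bochner's theorem for an integrable function with non-negative Fourier transform: the measure
has density `𝓕 h`. The factor `2 π` comes from the normalisation of `𝓕`. -/
lemma charFun_withDensity_fourier {h : ℝ → ℂ} (hi : Integrable h) (hc : Continuous h)
    (hpos : ∀ w, 0 ≤ 𝓕 h w) (t : ℝ) :
    charFun (volume.withDensity fun w ↦ ENNReal.ofReal (𝓕 h w).re) t = h (t / (2 * Real.pi)) := by
  have hcont : Continuous (𝓕 h) :=
    VectorFourier.fourierIntegral_continuous Real.continuous_fourierChar
      (by exact continuous_inner) hi
  have hre (w : ℝ) : ((𝓕 h w).re : ℂ) = 𝓕 h w := by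
    apply Complex.ext <;> simp [← (Complex.le_def.1 (hpos w)).2]
  have hFi : Integrable (𝓕 h) := by
    refine ⟨hcont.aestronglyMeasurable, ?_⟩
    rw [hasFiniteIntegral_iff_norm]
    refine lt_of_le_of_lt (lintegral_mono fun w ↦ ?_)
      ((lintegral_fourier_le hi hc.continuousAt hpos).trans_lt ENNReal.ofReal_lt_top)
    rw [← hre w, norm_real, Real.norm_of_nonneg (Complex.le_def.1 (hpos w)).1, ofReal_re]
  rw [← congrFun (hc.fourierInv_fourier_eq hi hFi) (t / (2 * Real.pi)), charFun_apply_real,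
    integral_withDensity_eq_integral_toReal_smul (by fun_prop)
    (ae_of_all _ fun _ ↦ ENNReal.ofReal_lt_top), Real.fourierInv_eq']
  congr 1 with w
  rw [ENNReal.toReal_ofReal (Complex.le_def.1 (hpos w)).1, Complex.real_smul, hre, smul_eq_mul,
    mul_comm]
  congr 2
  have : (Real.pi : ℂ) ≠ 0 := by exact_mod_cast Real.pi_ne_zero
  simp
  field_simp

/-! ### Shifting the line of integration -/

/-- The line of integration can be moved from `Im z = c` to `Im z = 0` when `H` is dominated, on
the closed strip between the two lines, by an integrable function of `Re z` vanishing at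
infinity. -/
lemma integral_comp_add_mul_I_eq {H : ℂ → ℂ} {c : ℝ} {B : ℝ → ℝ}
    (hH : DifferentiableOn ℂ H {z | z.im ∈ Set.uIcc 0 c})
    (hB : Integrable B) (hBtop : Tendsto B atTop (𝓝 0)) (hBbot : Tendsto B atBot (𝓝 0))
    (hHB : ∀ x : ℝ, ∀ y ∈ Set.uIcc 0 c, ‖H (x + y * I)‖ ≤ B x) :
    ∫ x : ℝ, H (x + c * I) = ∫ x : ℝ, H x := by
  have hint (y : ℝ) (hy : y ∈ Set.uIcc 0 c) : Integrable fun x : ℝ ↦ H (x + y * I) := by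
    refine hB.mono' (Continuous.aestronglyMeasurable ?_) (ae_of_all _ fun x ↦ hHB x y hy)
    exact hH.continuousOn.comp_continuous (by fun_prop) fun x ↦ by simpa using hy
  have hint0 : Integrable fun x : ℝ ↦ H x := by simpa using hint 0 Set.left_mem_uIcc
  have hrect (T : ℝ) := integral_boundary_rect_eq_zero_of_differentiableOn H (-T : ℝ) (T + c * I)
    (hH.mono fun z hz ↦ by simpa using hz.2)
  simp at hrect
  have hvert {l : Filter ℝ} (S : ℝ → ℝ) (hS : Tendsto (fun T ↦ B (S T)) l (𝓝 0)) :
      Tendsto (fun T ↦ I * ∫ y in (0 : ℝ)..c, H (S T + y * I)) l (𝓝 0) := by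
    refine squeeze_zero_norm (a := fun T ↦ B (S T) * |c - 0|) (fun T ↦ ?_)
      (by simpa using hS.mul_const |c|)
    rw [norm_mul, norm_I, one_mul]
    exact intervalIntegral.norm_integral_le_of_norm_le_const fun y hy ↦
      hHB _ y (Set.uIoc_subset_uIcc hy)
  have h1 := intervalIntegral_tendsto_integral hint0 tendsto_neg_atTop_atBot tendsto_id
  have h2 := intervalIntegral_tendsto_integral (hint c Set.right_mem_uIcc)
    tendsto_neg_atTop_atBot tendsto_id
  have h3 := hvert (l := atTop) id hBtop
  have h4 := hvert (l := atTop) (fun T ↦ -T) (hBbot.comp tendsto_neg_atTop_atBot)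
  have := ((h1.sub h2).add h3).sub h4
  simp only [id, ofReal_neg, hrect] at this
  have := tendsto_nhds_unique this tendsto_const_nhds
  linear_combination -this

/-! ### Limits of characteristic functions -/

/-- Existence part of Lévy's continuity theorem, with the bounds that weak limits inherit. -/
lemma exists_probabilityMeasure_charFun_eq {P : ℕ → ProbabilityMeasure ℝ} {φ : ℝ → ℂ}
    (hφ : ContinuousAt φ 0) (h : ∀ t, Tendsto (fun n ↦ charFun (P n : Measure ℝ) t) atTop (𝓝 (φ t))) :
    ∃ Q : ProbabilityMeasure ℝ, (∀ t, charFun (Q : Measure ℝ) t = φ t) ∧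
      ∀ (u : ℝ → ℝ) (C : ℝ≥0∞), Continuous u → 0 ≤ u →
        (∀ n, ∫⁻ x, ENNReal.ofReal (u x) ∂(P n : Measure ℝ) ≤ C) →
        ∫⁻ x, ENNReal.ofReal (u x) ∂(Q : Measure ℝ) ≤ C := by
  have htight := isTightMeasureSet_of_tendsto_charFun hφ h
  have hcomp : IsCompact (closure (Set.range P)) := by
    refine isCompact_closure_of_isTightMeasureSet (htight.subset ?_)
    rintro _ ⟨_, ⟨n, rfl⟩, rfl⟩
    exact ⟨n, rfl⟩
  obtain ⟨Q, -, s, hs, hQ⟩ := hcomp.tendsto_subseq fun n ↦ subset_closure (Set.mem_range_self n)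
  refine ⟨Q, fun t ↦ ?_, fun u C hu hu0 hC ↦ ?_⟩
  · exact tendsto_nhds_unique (ProbabilityMeasure.tendsto_iff_tendsto_charFun.1 hQ t)
      ((h t).comp hs.tendsto_atTop)
  · refine (lintegral_le_liminf_lintegral_of_forall_isOpen_measure_le_liminf_measure hu hu0
      fun G hG ↦ ProbabilityMeasure.le_liminf_measure_open_of_tendsto hQ hG).trans ?_
    refine liminf_le_of_le (by isBoundedDefault) fun b hb ↦ ?_
    obtain ⟨n, hn⟩ := hb.exists
    exact hn.trans (hC _)

/-! ### Fourier-Laplace transforms -/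

lemma fourierLaplace_eq_complexMGF (μ : Measure ℝ) (z : ℂ) :
    fourierLaplace μ z = complexMGF id μ (I * z) := rfl

lemma fourierLaplace_ofReal (μ : Measure ℝ) (x : ℝ) : fourierLaplace μ x = charFun μ x := by
  rw [charFun_apply_real, fourierLaplace]
  congr 1 with t
  ring_nf

lemma norm_cexp_I_mul (z : ℂ) (t : ℝ) : ‖cexp (I * z * t)‖ = Real.exp (-z.im * t) := by
  simp [Complex.norm_exp]

namespace IsExponentiallyFinite

variable {μ : Measure ℝ} {J : Set ℝ}

lemma integrable_cexp (h : IsExponentiallyFinite μ J) {z : ℂ} (hz : z.im ∈ J) :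
    Integrable (fun t : ℝ ↦ cexp (I * z * t)) μ := by
  refine ⟨by fun_prop, ?_⟩
  rw [hasFiniteIntegral_iff_norm]
  simpa only [norm_cexp_I_mul] using h _ hz

lemma differentiableOn_fourierLaplace (h : IsExponentiallyFinite μ J) (hJ : IsOpen J) :
    DifferentiableOn ℂ (fourierLaplace μ) {z | z.im ∈ J} := by
  intro z hz
  -- `(I * z).re = -z.im`, so `J` is reflected.
  have hsub : Neg.neg ⁻¹' J ⊆ integrableExpSet id μ := fun y hy ↦ by
    have := (h.integrable_cexp (z := (-y : ℝ) * I) (by simpa using hy)).norm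
    simp only [norm_cexp_I_mul] at this
    simpa [integrableExpSet] using this
  have hz' : (I * z).re ∈ interior (integrableExpSet id μ) :=
    interior_maximal hsub (hJ.preimage continuous_neg) (by simpa using hz)
  exact ((hasDerivAt_complexMGF hz').differentiableAt.comp z
    (by fun_prop : DifferentiableAt ℂ (fun z : ℂ ↦ I * z) z)).differentiableWithinAt

/-- The quadratic form of the matrix `[∫ exp (i (z k - conj (z l)) t) dμ(t)]` is
`∫ |∑ k, ξ k exp (i (z k) t)|² dμ(t)`. -/
lemma isPositiveDefiniteOn_fourierLaplace (h : IsExponentiallyFinite μ J) :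
    IsPositiveDefiniteOn (fourierLaplace μ) {z | z.im ∈ J} := by
  intro n z hz ξ
  have hint (k l : Fin n) :
      Integrable (fun t : ℝ ↦ cexp (I * (z k - conj (z l)) * t) * ξ k * conj (ξ l)) μ :=
    ((h.integrable_cexp (hz k l)).mul_const _).mul_const _
  have heq : ∑ k, ∑ l, fourierLaplace μ (z k - conj (z l)) * ξ k * conj (ξ l)
      = ∫ t : ℝ, ∑ k, ∑ l, cexp (I * (z k - conj (z l)) * t) * ξ k * conj (ξ l) ∂μ := by
    rw [integral_finsetSum _ fun k _ ↦ integrable_finsetSum _ fun l _ ↦ hint k l]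
    simp_rw [integral_finsetSum _ fun l _ ↦ hint _ l, integral_mul_const]
    rfl
  rw [heq]
  refine integral_nonneg fun t ↦ ?_
  have : ∑ k, ∑ l, cexp (I * (z k - conj (z l)) * t) * ξ k * conj (ξ l)
      = (∑ k, ξ k * cexp (I * z k * t)) * conj (∑ k, ξ k * cexp (I * z k * t)) := by
    rw [map_sum, Finset.sum_mul_sum]
    refine Finset.sum_congr rfl fun k _ ↦ Finset.sum_congr rfl fun l _ ↦ ?_
    have : cexp (I * (z k - conj (z l)) * t)
        = cexp (I * z k * t) * conj (cexp (I * z l * t)) := by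
      rw [← Complex.exp_conj, ← Complex.exp_add]
      congr 1
      simp
      ring
    rw [this, map_mul]
    ring
  simp only [Pi.zero_apply, this, Complex.mul_conj']
  rw [← ofReal_pow, Complex.zero_le_real]
  positivity

end IsExponentiallyFinite

lemma withDensity_exp_inj {μ ν : Measure ℝ} (c : ℝ)
    (h : μ.withDensity (fun t ↦ ENNReal.ofReal (Real.exp (c * t)))
      = ν.withDensity fun t ↦ ENNReal.ofReal (Real.exp (c * t))) : μ = ν := by
  have hm : Measurable fun t : ℝ ↦ ENNReal.ofReal (Real.exp (c * t)) := by fun_prop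
  have h0 (ρ : Measure ℝ) := withDensity_inv_same (μ := ρ) hm
    (ae_of_all _ fun t ↦ by simp [Real.exp_pos]) (ae_of_all _ fun t ↦ ENNReal.ofReal_ne_top)
  rw [← h0 μ, h, h0 ν]

lemma fourierLaplace_withDensity_exp (μ : Measure ℝ) (c : ℝ) (z : ℂ) :
    fourierLaplace (μ.withDensity fun t ↦ ENNReal.ofReal (Real.exp (-c * t))) z
      = fourierLaplace μ (z + c * I) := by
  rw [fourierLaplace, integral_withDensity_eq_integral_toReal_smul (by fun_prop)
    (ae_of_all _ fun _ ↦ ENNReal.ofReal_lt_top), fourierLaplace]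
  congr 1 with t
  rw [ENNReal.toReal_ofReal (Real.exp_nonneg _), Complex.real_smul, Complex.ofReal_exp,
    ← Complex.exp_add]
  congr 1
  push_cast
  linear_combination (- c * t : ℂ) * I_sq

/-- Values on one horizontal line already determine the measure. -/
lemma IsExponentiallyFinite.ext_of_fourierLaplace {μ ν : Measure ℝ} {J : Set ℝ} {c : ℝ}
    (hc : c ∈ J) (hμ : IsExponentiallyFinite μ J) (hν : IsExponentiallyFinite ν J)
    (h : ∀ x : ℝ, fourierLaplace μ (x + c * I) = fourierLaplace ν (x + c * I)) : μ = ν := by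
  refine withDensity_exp_inj (-c) ?_
  have := isFiniteMeasure_withDensity (hμ c hc).ne
  have := isFiniteMeasure_withDensity (hν c hc).ne
  refine Measure.ext_of_charFun (funext fun x ↦ ?_)
  simp_rw [← fourierLaplace_ofReal, fourierLaplace_withDensity_exp, h]

/-! ### Holomorphic positive definite functions on a strip -/

section Strip

variable {J : Set ℝ} {f : ℂ → ℂ}

lemma isOpen_strip (hJ : IsOpen J) : IsOpen {z : ℂ | z.im ∈ J} := hJ.preimage continuous_im

lemma eq_on_strip_of_eq_on_real {g : ℂ → ℂ} (hJ : IsOpen J) (hJc : J.OrdConnected) (h0 : 0 ∈ J)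
    (hf : DifferentiableOn ℂ f {z | z.im ∈ J}) (hg : DifferentiableOn ℂ g {z | z.im ∈ J})
    (h : ∀ x : ℝ, f x = g x) {z : ℂ} (hz : z.im ∈ J) : f z = g z := by
  refine AnalyticOnNhd.eqOn_of_preconnected_of_frequently_eq (z₀ := 0)
    (hf.analyticOnNhd (isOpen_strip hJ)) (hg.analyticOnNhd (isOpen_strip hJ))
    (hJc.convex.linear_preimage imLm).isPreconnected (by simpa using h0) ?_ hz
  have ht : Tendsto (fun x : ℝ ↦ (x : ℂ)) (𝓝[≠] 0) (𝓝[≠] 0) := by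
    refine tendsto_nhdsWithin_iff.2 ⟨?_, ?_⟩
    · simpa using (continuous_ofReal.tendsto 0).mono_left nhdsWithin_le_nhds
    · filter_upwards [self_mem_nhdsWithin] with x hx
      simpa using hx
  exact ht.frequently (Frequently.of_forall h)

/-- Raising both points by `c / 2` raises `z - conj w` by `c`. -/
lemma add_half_sub_conj (z w : ℂ) (c : ℝ) :
    z + (c / 2 : ℝ) * I - conj (w + (c / 2 : ℝ) * I) = z - conj w + c * I := by
  simp only [map_add, map_mul, conj_ofReal, conj_I]
  push_cast
  ring

namespace IsPositiveDefiniteOn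

lemma slice (hpd : IsPositiveDefiniteOn f {z | z.im ∈ J}) {y : ℝ} (hy : y ∈ J) :
    IsPositiveDefiniteReal fun x : ℝ ↦ f (x + y * I) := by
  intro n x ξ
  have e (k l : Fin n) : (x k + (y / 2 : ℝ) * I : ℂ) - conj (x l + (y / 2 : ℝ) * I : ℂ)
      = ((x k - x l : ℝ) : ℂ) + y * I := by
    rw [add_half_sub_conj]
    simp
  have := hpd n (fun k ↦ x k + (y / 2 : ℝ) * I) (fun k l ↦ by
    simp only [e, Set.mem_ofPred_eq]
    simpa using hy) ξ
  simpa only [e] using this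

end IsPositiveDefiniteOn

lemma continuous_slice (hf : DifferentiableOn ℂ f {z | z.im ∈ J}) {y : ℝ} (hy : y ∈ J) :
    Continuous fun x : ℝ ↦ f (x + y * I) :=
  hf.continuousOn.comp_continuous (by fun_prop) fun x ↦ by simpa using hy

/-- The restriction of `z ↦ f z * exp (-z² / (2 v))` to the line `Im z = y`. -/
noncomputable def gaussianSlice (f : ℂ → ℂ) (v : ℝ≥0) (y x : ℝ) : ℂ :=
  f (x + y * I) * cexp (-(x + y * I) ^ 2 / (2 * v))

lemma norm_cexp_gaussian (v : ℝ≥0) (x y : ℝ) :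
    ‖cexp (-(x + y * I) ^ 2 / (2 * v))‖
      = Real.exp (y ^ 2 / (2 * v)) * Real.exp (-(2 * (v : ℝ))⁻¹ * x ^ 2) := by
  have : (-(x + y * I) ^ 2 / (2 * v) : ℂ)
      = ((y ^ 2 / (2 * v) + -(2 * (v : ℝ))⁻¹ * x ^ 2 : ℝ) : ℂ) + (-(x * y / v) : ℝ) * I := by
    push_cast
    linear_combination (-(y : ℂ) ^ 2 / (2 * v)) * I_sq
  rw [this, Complex.norm_exp, ← Real.exp_add]
  simp only [add_re, ofReal_re, re_ofReal_mul, I_re, mul_zero, add_zero]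

lemma continuous_gaussianSlice (hf : DifferentiableOn ℂ f {z | z.im ∈ J}) (v : ℝ≥0) {y : ℝ}
    (hy : y ∈ J) : Continuous (gaussianSlice f v y) :=
  (continuous_slice hf hy).mul (by fun_prop)

lemma integrable_gaussianSlice (hf : DifferentiableOn ℂ f {z | z.im ∈ J})
    (hpd : IsPositiveDefiniteOn f {z | z.im ∈ J}) {v : ℝ≥0} (hv : v ≠ 0) {y : ℝ} (hy : y ∈ J) :
    Integrable (gaussianSlice f v y) := by
  have hv' : (0 : ℝ) < (2 * (v : ℝ))⁻¹ := by positivity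
  refine (((integrable_exp_neg_mul_sq hv').const_mul (Real.exp (y ^ 2 / (2 * v)))).const_mul
    (f ((0 : ℝ) + y * I)).re).mono' (continuous_gaussianSlice hf v hy).aestronglyMeasurable
    (ae_of_all _ fun x ↦ ?_)
  rw [gaussianSlice, norm_mul, norm_cexp_gaussian]
  gcongr
  exact (hpd.slice hy).norm_le x

/-- Since `|f (x + i y)| ≤ f (i y)` is bounded for `y` between `0` and `c`, the line of integration
can be moved from `Im z = c` to `Im z = 0` in the Fourier integral of
`z ↦ f z * exp (-z² / (2 v))`. -/
lemma fourier_gaussianSlice (hJc : J.OrdConnected) (h0 : 0 ∈ J)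
    (hf : DifferentiableOn ℂ f {z | z.im ∈ J})
    (hpd : IsPositiveDefiniteOn f {z | z.im ∈ J}) {v : ℝ≥0} (hv : v ≠ 0) {c : ℝ} (hc : c ∈ J)
    (w : ℝ) :
    𝓕 (gaussianSlice f v c) w
      = Real.exp (-(2 * Real.pi * c * w)) * 𝓕 (gaussianSlice f v 0) w := by
  have hsub : Set.uIcc 0 c ⊆ J := hJc.uIcc_subset h0 hc
  have hv' : (0 : ℝ) < (2 * (v : ℝ))⁻¹ := by positivity
  obtain ⟨M, hM⟩ : ∃ M, ∀ y ∈ Set.uIcc 0 c, ‖f (y * I)‖ ≤ M :=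
    isCompact_uIcc.exists_bound_of_continuousOn (hf.continuousOn.comp (by fun_prop)
      fun y hy ↦ by simpa using hsub hy)
  let H : ℂ → ℂ := fun z ↦ cexp (-(2 * Real.pi * w * I) * z) * (f z * cexp (-z ^ 2 / (2 * v)))
  let K : ℝ := Real.exp (2 * Real.pi * |w| * |c|) * (M * Real.exp (c ^ 2 / (2 * v)))
  have hH : DifferentiableOn ℂ H {z | z.im ∈ Set.uIcc 0 c} :=
    DifferentiableOn.mul (by fun_prop) ((hf.mono fun z hz ↦ hsub hz).mul (by fun_prop))
  have hdec : Tendsto (fun u : ℝ ↦ Real.exp (-(2 * (v : ℝ))⁻¹ * u)) atTop (𝓝 0) :=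
    Real.tendsto_exp_atBot.comp (tendsto_id.const_mul_atTop_of_neg (neg_neg_of_pos hv'))
  have hshift := integral_comp_add_mul_I_eq (H := H) (c := c)
    (B := fun x ↦ K * Real.exp (-(2 * (v : ℝ))⁻¹ * x ^ 2)) hH
    ((integrable_exp_neg_mul_sq hv').const_mul _)
    (by simpa using (hdec.comp (tendsto_pow_atTop two_ne_zero)).const_mul K)
    (by simpa using (hdec.comp (tendsto_pow_atTop two_ne_zero |>.comp
      tendsto_abs_atBot_atTop)).const_mul K) (fun x y hy ↦ by
      have hyc : |y| ≤ |c| := by simpa using Set.abs_sub_left_of_mem_uIcc hy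
      have hM' : ‖f (x + y * I)‖ ≤ M := by
        refine ((hpd.slice (hsub hy)).norm_le x).trans ((re_le_norm _).trans ?_)
        simpa using hM y hy
      have hM0 : 0 ≤ M := (norm_nonneg _).trans hM'
      have hexp : ‖cexp (-(2 * Real.pi * w * I) * (x + y * I))‖
          ≤ Real.exp (2 * Real.pi * |w| * |c|) := by
        rw [Complex.norm_exp, Real.exp_le_exp]
        simp
        calc 2 * Real.pi * w * y ≤ |2 * Real.pi * w * y| := le_abs_self _
          _ = 2 * Real.pi * |w| * |y| := by
            simp [abs_mul, abs_of_pos Real.pi_pos]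
          _ ≤ _ := by gcongr
      rw [norm_mul, norm_mul, norm_cexp_gaussian]
      have : y ^ 2 ≤ c ^ 2 := sq_le_sq.2 hyc
      calc _ ≤ Real.exp (2 * Real.pi * |w| * |c|)
            * (M * (Real.exp (c ^ 2 / (2 * v)) * Real.exp (-(2 * (v : ℝ))⁻¹ * x ^ 2))) := by gcongr
        _ = _ := by ring)
  have e1 : ∫ x : ℝ, H (x + c * I)
      = Real.exp (2 * Real.pi * c * w) * 𝓕 (gaussianSlice f v c) w := by
    rw [Real.fourier_real_eq_integral_exp_smul, ← integral_const_mul]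
    congr 1 with x
    simp only [H, gaussianSlice, smul_eq_mul]
    rw [← mul_assoc (Real.exp _ : ℂ), Complex.ofReal_exp, ← Complex.exp_add]
    congr 2
    push_cast
    linear_combination (-(2 * Real.pi * w * c) : ℂ) * I_sq
  have e2 : ∫ x : ℝ, H x = 𝓕 (gaussianSlice f v 0) w := by
    rw [Real.fourier_real_eq_integral_exp_smul]
    congr 1 with x
    simp only [H, gaussianSlice, smul_eq_mul, ofReal_zero, zero_mul, add_zero]
    congr 2
    push_cast
    ring
  rw [← e2, ← hshift, e1, ← mul_assoc, ← ofReal_mul, ← Real.exp_add]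
  simp

lemma fourier_gaussianSlice_nonneg (hJc : J.OrdConnected) (h0 : 0 ∈ J)
    (hf : DifferentiableOn ℂ f {z | z.im ∈ J})
    (hpd : IsPositiveDefiniteOn f {z | z.im ∈ J}) {v : ℝ≥0} (hv : v ≠ 0) {c : ℝ} (hc : c ∈ J)
    (w : ℝ) : 0 ≤ 𝓕 (gaussianSlice f v c) w := by
  rw [fourier_gaussianSlice hJc h0 hf hpd hv hc]
  refine mul_nonneg (by rw [Complex.zero_le_real]; positivity) ?_
  have := (hpd.slice h0).fourier_mul_gaussian_nonneg (continuous_slice hf h0) hv w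
  unfold gaussianSlice
  simpa using this

/-- On every line `Im z = y` the damped function is the transform of one density
`w ↦ exp (-2 π y w) * 𝓕 (gaussianSlice f v 0) w`, up to normalisation. As `v → ∞` these densities
have a weak limit; its exponential moments are finite by Fatou's lemma, and its Fourier-Laplace
transform agrees with `f` on the real line, hence on the strip. -/
lemma exists_fourierLaplace_eq_of_apply_zero_eq_one (hJ : IsOpen J) (hJc : J.OrdConnected)
    (h0 : 0 ∈ J) (hf : DifferentiableOn ℂ f {z | z.im ∈ J})
    (hpd : IsPositiveDefiniteOn f {z | z.im ∈ J}) (hf0 : f 0 = 1) :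
    ∃ μ : Measure ℝ, IsExponentiallyFinite μ J ∧ ∀ z, z.im ∈ J → f z = fourierLaplace μ z := by
  let v (n : ℕ) : ℝ≥0 := n + 1
  have hv (n : ℕ) : v n ≠ 0 := by positivity
  let m (n : ℕ) : Measure ℝ :=
    volume.withDensity fun w ↦ ENNReal.ofReal (𝓕 (gaussianSlice f (v n) 0) w).re
  have hchar (n : ℕ) (t : ℝ) : charFun (m n) t = gaussianSlice f (v n) 0 (t / (2 * Real.pi)) :=
    charFun_withDensity_fourier (integrable_gaussianSlice hf hpd (hv n) h0)
      (continuous_gaussianSlice hf _ h0)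
      (fun w ↦ fourier_gaussianSlice_nonneg hJc h0 hf hpd (hv n) h0 w) t
  have hprob (n : ℕ) : IsProbabilityMeasure (m n) := by
    have h1 := hchar n 0
    simp [gaussianSlice, hf0] at h1
    refine ⟨?_⟩
    have h2 : (m n).real Set.univ = 1 := by exact_mod_cast h1
    rwa [measureReal_def, ENNReal.toReal_eq_one_iff] at h2
  have hlim (t : ℝ) : Tendsto (fun n ↦ charFun (m n) t) atTop
      (𝓝 (f ((t / (2 * Real.pi) : ℝ) + (0 : ℝ) * I))) := by
    simp_rw [hchar, gaussianSlice]
    have hv0 : Tendsto (fun n : ℕ ↦ ((((n : ℝ) + 1)⁻¹ : ℝ) : ℂ)) atTop (𝓝 ((0 : ℝ) : ℂ)) :=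
      (continuous_ofReal.tendsto _).comp (tendsto_inv_atTop_zero.comp
        (tendsto_atTop_add_const_right atTop (1 : ℝ) tendsto_natCast_atTop_atTop))
    have h1 := ((Complex.continuous_exp.tendsto _).comp (hv0.const_mul
      (-(((t / (2 * Real.pi) : ℝ) : ℂ) + (0 : ℝ) * I) ^ 2 / 2))).const_mul
      (f ((t / (2 * Real.pi) : ℝ) + (0 : ℝ) * I))
    simp only [ofReal_zero, mul_zero, Complex.exp_zero, mul_one] at h1
    simp only [ofReal_zero]
    refine h1.congr fun n ↦ ?_
    simp only [Function.comp_apply, v]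
    congr 2
    push_cast
    rw [div_mul_eq_div_div _ 2 ((n : ℂ) + 1), div_eq_mul_inv _ ((n : ℂ) + 1)]
  obtain ⟨Q, hQ, hQle⟩ := exists_probabilityMeasure_charFun_eq
    (P := fun n ↦ ⟨m n, hprob n⟩)
    (φ := fun t : ℝ ↦ f ((t / (2 * Real.pi) : ℝ) + (0 : ℝ) * I))
    ((continuous_slice hf h0).comp (by fun_prop : Continuous fun t : ℝ ↦ t / (2 * Real.pi))
      |>.continuousAt) hlim
  have hexp : IsExponentiallyFinite ((Q : Measure ℝ).map (2 * Real.pi * ·)) J := by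
    intro y hy
    rw [lintegral_map (by fun_prop) (by fun_prop)]
    refine lt_of_le_of_lt (hQle (fun w ↦ Real.exp (-y * (2 * Real.pi * w)))
      (ENNReal.ofReal ((f (y * I)).re * Real.exp (y ^ 2 / 2))) (by fun_prop)
      (fun w ↦ Real.exp_nonneg _) fun n ↦ ?_) ENNReal.ofReal_lt_top
    have hFc : Continuous (𝓕 (gaussianSlice f (v n) 0)) :=
      VectorFourier.fourierIntegral_continuous Real.continuous_fourierChar
        (by exact continuous_inner) (integrable_gaussianSlice hf hpd (hv n) h0)
    change ∫⁻ w, _ ∂(m n) ≤ _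
    rw [lintegral_withDensity_eq_lintegral_mul _ (by fun_prop) (by fun_prop)]
    calc _ = ∫⁻ w, ENNReal.ofReal (𝓕 (gaussianSlice f (v n) y) w).re := by
          congr 1 with w
          rw [fourier_gaussianSlice hJc h0 hf hpd (hv n) hy, Complex.re_ofReal_mul,
            ENNReal.ofReal_mul (Real.exp_nonneg _), Pi.mul_apply, mul_comm]
          congr 3
          ring
      _ ≤ ENNReal.ofReal (gaussianSlice f (v n) y 0).re :=
          lintegral_fourier_le (integrable_gaussianSlice hf hpd (hv n) hy)
            (continuous_gaussianSlice hf _ hy).continuousAt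
            (fun w ↦ fourier_gaussianSlice_nonneg hJc h0 hf hpd (hv n) hy w)
      _ ≤ _ := by
          have hfy : 0 ≤ (f (y * I)).re := by
            have := (Complex.le_def.1 (hpd.slice hy).apply_zero_nonneg).1
            simpa using this
          have e : gaussianSlice f (v n) y 0
              = f (y * I) * (Real.exp (y ^ 2 / (2 * v n)) : ℝ) := by
            simp [gaussianSlice, mul_pow]
          rw [e, Complex.re_mul_ofReal]
          gcongr
          simp [v]
  refine ⟨_, hexp, fun z hz ↦ eq_on_strip_of_eq_on_real hJ hJc h0 hf
    (hexp.differentiableOn_fourierLaplace hJ) (fun x ↦ ?_) hz⟩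
  rw [fourierLaplace_ofReal, charFun_map_mul, hQ]
  have := Real.pi_ne_zero
  congr 1
  simp

/-- The general case follows by dividing `f` by `f 0 ≥ 0`; if `f 0 = 0`, then `|f x| ≤ f 0` makes
`f` vanish on the real line, hence on the strip. -/
lemma exists_fourierLaplace_eq_of_zero_mem (hJ : IsOpen J) (hJc : J.OrdConnected) (h0 : 0 ∈ J)
    (hf : DifferentiableOn ℂ f {z | z.im ∈ J}) (hpd : IsPositiveDefiniteOn f {z | z.im ∈ J}) :
    ∃ μ : Measure ℝ, IsExponentiallyFinite μ J ∧ ∀ z, z.im ∈ J → f z = fourierLaplace μ z := by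
  have hslice := hpd.slice h0
  obtain ⟨r, hr, hfr⟩ : ∃ r : ℝ, 0 ≤ r ∧ f 0 = r := by
    have h := Complex.le_def.1 hslice.apply_zero_nonneg
    simp at h
    exact ⟨(f 0).re, h.1, Complex.ext (by simp) (by simp [← h.2])⟩
  rcases hr.eq_or_lt with rfl | hr
  · refine ⟨0, fun y _ ↦ by simp, fun z hz ↦ ?_⟩
    refine eq_on_strip_of_eq_on_real hJ hJc h0 hf (g := fourierLaplace 0)
      (IsExponentiallyFinite.differentiableOn_fourierLaplace (fun y _ ↦ by simp) hJ)
      (fun x ↦ ?_) hz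
    have := hslice.norm_le x
    simpa [hfr, fourierLaplace] using this
  · have hr' : (r : ℂ) ≠ 0 := by exact_mod_cast hr.ne'
    obtain ⟨μ, hμ, hfμ⟩ := exists_fourierLaplace_eq_of_apply_zero_eq_one hJ hJc h0
      (f := fun z ↦ (r⁻¹ : ℝ) * f z) (hf.const_mul _) (fun n z hz ξ ↦ by
        have h1 : (0 : ℂ) ≤ (r⁻¹ : ℝ) := by rw [Complex.zero_le_real]; positivity
        convert mul_nonneg h1 (hpd n z hz ξ) using 1
        simp only [Finset.mul_sum, mul_assoc]) (by simp [hfr, hr'])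
    refine ⟨ENNReal.ofReal r • μ, fun y hy ↦ ?_, fun z hz ↦ ?_⟩
    · rw [lintegral_smul_measure]
      exact ENNReal.mul_lt_top ENNReal.ofReal_lt_top (hμ y hy)
    · have : fourierLaplace (ENNReal.ofReal r • μ) z = r * fourierLaplace μ z := by
        simp [fourierLaplace, integral_smul_measure, ENNReal.toReal_ofReal hr.le]
      rw [this, ← hfμ z hz, ofReal_inv, mul_inv_cancel_left₀ hr']

/-- For `c ∈ J`, the measure of `z ↦ f (z + i c)` is `exp (-c t)` times the measure of `f`. -/
theorem exists_fourierLaplace_eq (hJ : IsOpen J) (hJc : J.OrdConnected) (hne : J.Nonempty)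
    (hf : DifferentiableOn ℂ f {z | z.im ∈ J}) (hpd : IsPositiveDefiniteOn f {z | z.im ∈ J}) :
    ∃ μ : Measure ℝ, IsExponentiallyFinite μ J ∧ ∀ z, z.im ∈ J → f z = fourierLaplace μ z := by
  obtain ⟨c, hc⟩ := hne
  obtain ⟨μ, hμ, hfμ⟩ := exists_fourierLaplace_eq_of_zero_mem (J := (· + c) ⁻¹' J)
    (f := fun z ↦ f (z + c * I)) (hJ.preimage (by fun_prop))
    (hJc.preimage_mono fun x y h ↦ by simpa using h) (by simpa using hc)
    (hf.comp (by fun_prop) fun z hz ↦ by simpa using hz) (fun n z hz ξ ↦ by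
      have := hpd n (fun k ↦ z k + (c / 2 : ℝ) * I) (fun k l ↦ by
        simpa only [add_half_sub_conj, Set.mem_ofPred_eq, Set.mem_preimage, add_im, re_ofReal_mul, im_ofReal_mul, I_im,
          mul_one] using hz k l) ξ
      simpa only [add_half_sub_conj] using this)
  refine ⟨μ.withDensity fun t ↦ ENNReal.ofReal (Real.exp (-(-c) * t)), fun y hy ↦ ?_,
    fun z hz ↦ ?_⟩
  · rw [lintegral_withDensity_eq_lintegral_mul _ (by fun_prop) (by fun_prop)]
    convert hμ (y - c) (by simpa using hy) using 3 with t
    rw [Pi.mul_apply, ← ENNReal.ofReal_mul (Real.exp_nonneg _), ← Real.exp_add]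
    ring_nf
  · rw [fourierLaplace_withDensity_exp, ← hfμ _ (by simpa using hz)]
    simp

end Strip

/-! ### The strip with extended real endpoints -/

lemma isOpen_openInterval (a b : EReal) : IsOpen (openInterval a b) :=
  isOpen_Ioo.preimage continuous_coe_real_ereal

lemma ordConnected_openInterval (a b : EReal) : (openInterval a b).OrdConnected :=
  ⟨fun _ hx _ hy _ hz ↦ ⟨hx.1.trans_le (EReal.coe_le_coe_iff.2 hz.1),
    (EReal.coe_le_coe_iff.2 hz.2).trans_lt hy.2⟩⟩

lemma nonempty_openInterval {a b : EReal} (hab : a < b) : (openInterval a b).Nonempty :=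
  EReal.lt_iff_exists_real_btwn.1 hab

theorem mainTheorem1 (a b : EReal) (hab : a < b) (f : ℂ → ℂ) :
    ((DifferentiableOn ℂ f (horizontalStrip a b) ∧
        IsPositiveDefiniteOn f (horizontalStrip a b)) ↔
      ∃ μ : MeasureTheory.Measure ℝ, IsExponentiallyFinite μ (openInterval a b) ∧
        ∀ z ∈ horizontalStrip a b, f z = fourierLaplace μ z) ∧
    (∀ μ ν : MeasureTheory.Measure ℝ,
      IsExponentiallyFinite μ (openInterval a b) →
      IsExponentiallyFinite ν (openInterval a b) →
      (∀ z ∈ horizontalStrip a b, f z = fourierLaplace μ z) →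
      (∀ z ∈ horizontalStrip a b, f z = fourierLaplace ν z) →
      μ = ν) := by
  have hJ := isOpen_openInterval a b
  obtain ⟨c, hc⟩ := nonempty_openInterval hab
  refine ⟨⟨fun ⟨hf, hpd⟩ ↦ exists_fourierLaplace_eq hJ (ordConnected_openInterval a b) ⟨c, hc⟩
    hf hpd, ?_⟩, fun μ ν hμ hν hfμ hfν ↦ ?_⟩
  · rintro ⟨μ, hμ, hfμ⟩
    refine ⟨(hμ.differentiableOn_fourierLaplace hJ).congr hfμ, fun n z hz ξ ↦ ?_⟩
    simpa only [hfμ _ (hz _ _)] using hμ.isPositiveDefiniteOn_fourierLaplace n z hz ξ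
  · refine hμ.ext_of_fourierLaplace hc hν fun x ↦ ?_
    have hx : (x + c * I : ℂ) ∈ horizontalStrip a b :=
      ⟨by simpa using hc.1, by simpa using hc.2⟩
    rw [← hfμ _ hx, hfν _ hx]
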